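/- Let $\lambda>0$ and let $\kappa:\mathbb{N}\to\mathbb{R}$ satisfy $\kappa(\Delta)=o(\Delta)$ as $\Delta\to\infty$. There are functions $\varepsilon_1,\varepsilon_2:\mathbb{N}\to\mathbb{R}$ with $\varepsilon_1(\Delta)\to0$ and $\varepsilon_2(\Delta)\to0$ as $\Delta\to\infty$ such that, for all sufficiently large $\Delta$ (how large, like $\varepsilon_1,\varepsilon_2$, depending only on $\lambda$ and $\kappa$), the following holds for every integer $k$ with $3\le k\le\kappa(\Delta)$ and every finite simple graph $G$ of maximum degree $\Delta$ that is $C_k$-free, i.e. contains no (not necessarily induced) cycle on $k$ vertices as a subgraph: \[ \alpha_G(\lambda)\ \ge\ (1-\varepsilon_1(\Delta))\,\frac{\log(\Delta/k)}{\Delta} \qquad\text{and}\qquad \chi_f(G)\ \le\ (1+\varepsilon_2(\Delta))\,\frac{\Delta}{\log(\Delta/k)} . \] Here $\log$ is the natural logarithm. The quantity $\alpha_G(\lambda)=\mathbb{E}|X|/|V(G)|$ is the occupancy fraction of the hard-core model on $G$ at fugacity $\lambda$: $X$ is a random independent set of $G$ (possibly empty) with $\Pr(X=I)=\lambda^{|I|}/\sum_{J}\lambda^{|J|}$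 for each independent set $I$, the sum being over all independent sets $J$ of $G$. The fractional chromatic number $\chi_f(G)$ is the least real $x>0$ for which there is a probability distribution on the independent sets of $G$ such that each vertex of $G$ belongs to the random independent set with probability at least $1/x$. -/

import Mathlib

open Filter Topology Asymptotics

namespace HardCore

variable {V : Type*} [Fintype V]

open Classical in
/-- The collection of all independent sets of a finite graph `G` (including the empty set). -/
noncomputable def indepSets (G : SimpleGraph V) : Finset (Finset V) :=
  Finset.univ.filter fun I => G.IsIndepSet (I : Set V)

/-- The partition function of the hard-core model on `G` at fugacity `lam`. -/
noncomputable def partitionFunction (G : SimpleGraph V) (lam : ℝ) : ℝ :=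
  ∑ J ∈ indepSets G, lam ^ J.card

/-- The probability of the independent set `I` in the hard-core model on `G` at fugacity `lam`. -/
noncomputable def prob (G : SimpleGraph V) (lam : ℝ) (I : Finset V) : ℝ :=
  lam ^ I.card / partitionFunction G lam

/-- The expected size of a random independent set drawn from the hard-core model. -/
noncomputable def expectedSize (G : SimpleGraph V) (lam : ℝ) : ℝ :=
  ∑ I ∈ indepSets G, prob G lam I * (I.card : ℝ)

/-- The occupancy fraction of the hard-core model: expected size over number of vertices. -/
noncomputable def occupancyFraction (G : SimpleGraph V) (lam : ℝ) : ℝ :=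
  expectedSize G lam / (Fintype.card V : ℝ)

open Classical in
/-- `w` is a fractional `x`-colouring of `G`: a probability distribution on the independent sets
of `G` such that each vertex lies in the random independent set with probability at
least `1 / x`. -/
structure IsFractionalColouring (G : SimpleGraph V) (x : ℝ) (w : Finset V → ℝ) : Prop where
  nonneg : ∀ I ∈ indepSets G, 0 ≤ w I
  sum_eq_one : ∑ I ∈ indepSets G, w I = 1
  le_prob : ∀ u : V, 1 / x ≤ ∑ I ∈ (indepSets G).filter (fun I => u ∈ I), w I

/-- The fractional chromatic number: the least real `x > 0` for which `G` admits a
fractional `x`-colouring. -/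
noncomputable def fractionalChromaticNumber (G : SimpleGraph V) : ℝ :=
  sInf {x : ℝ | 0 < x ∧ ∃ w : Finset V → ℝ, IsFractionalColouring G x w}

end HardCore

/-!
The proof is by local occupancy. Fix a vertex `u` of a vertex set `S` and reveal a random
independent set `I` inside `S` outside the neighbourhood of `u`. What remains is a hard-core model
on the set `F` of neighbours of `u` that are still available. Outside its neighbourhood
`u` is isolated and occupied with odds `lam`, so its occupancy is governed by the chance that `F` stays empty,
while the expected number of occupied neighbours is governed by the hard-core model on `F`. An
inequality `Z_F ≤ β * lam / (1 + lam) + γ * ∑ v ∈ F, Z_F * P(v ∈ I)` for all possible `F` therefore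
gives `β * P(u ∈ I) + γ * E|N(u) ∩ I| ≥ 1` (`partitionIn_le_of_neighborhood`).

Summing over all `u` yields the occupancy fraction at least `1 / (β + γ * Δ)`
(`one_div_le_occupancyFraction`), and a greedy fractional colouring driven by the hard-core models
on the vertices whose demand is not yet met has total weight at most `β + γ * Δ`
(`exists_weights_of_localOccupancy`).

In a graph without a `k`-cycle, a neighbourhood contains no path on `k - 1` vertices, so it is
`(k - 3)`-degenerate and `F` has average degree at most `2 * (k - 2)`
(`exists_degree_lt_of_cycleGraph_free`, `sum_degree_le_of_degenerate`). At the small fugacity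
`μ = η / (2 * k)` the vertices of `F` then hardly interact: `Z_F ≤ exp (μ * |F|)` and the expected
number of occupied vertices is at least `(1 - η) * μ * |F|`. With `L = log (η ^ 2 * Δ / k)`, the
choice `γ = 1 / (L * (1 - η))` and `β = (1 + μ) / μ * exp L / L` satisfies the local inequality
(`partitionIn_le_of_sparse`), and `β + γ * Δ ≤ (4 * η + 1 / (1 - η)) * Δ / L`, which is
`(1 + o(1)) * Δ / log (Δ / k)` as `η → 0` slowly enough. The occupancy fraction increases with the
fugacity (`expectedSize_mono`), so the bound at `μ` carries over to every fixed fugacity.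
-/

namespace HardCore

/-! ### The hard-core model on subsets of the vertices -/

section Subsets

variable {V : Type*} (G : SimpleGraph V) (lam : ℝ)

open Classical in
/-- The independent sets of `G` contained in `S`; equivalently, those of the subgraph induced
by `S`. -/
noncomputable def indepSetsIn (S : Finset V) : Finset (Finset V) :=
  S.powerset.filter fun I => G.IsIndepSet (I : Set V)

/-- The partition function of the hard-core model on the subgraph induced by `S`. -/
noncomputable def partitionIn (S : Finset V) : ℝ :=
  ∑ I ∈ indepSetsIn G S, lam ^ I.card

open Classical in
/-- The total weight of the independent sets inside `S` that contain `v`. Dividing it by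
`partitionIn G lam S` gives the probability that `v` is occupied. -/
noncomputable def occupiedWeight (S : Finset V) (v : V) : ℝ :=
  ∑ I ∈ (indepSetsIn G S).filter (fun I => v ∈ I), lam ^ I.card

variable {G lam}

theorem mem_indepSetsIn {S I : Finset V} :
    I ∈ indepSetsIn G S ↔ I ⊆ S ∧ ∀ v ∈ I, ∀ w ∈ I, ¬ G.Adj v w := by
  classical
  simp only [indepSetsIn, Finset.mem_filter, Finset.mem_powerset, SimpleGraph.IsIndepSet]
  refine and_congr_right fun _ => ⟨fun h v hv w hw hvw => h hv hw hvw.ne hvw,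
    fun h v hv w hw _ => h v hv w hw⟩

theorem indepSetsIn_mono {S T : Finset V} (h : S ⊆ T) : indepSetsIn G S ⊆ indepSetsIn G T := by
  intro I hI
  rw [mem_indepSetsIn] at hI ⊢
  exact ⟨hI.1.trans h, hI.2⟩

theorem partitionIn_empty : partitionIn G lam ∅ = 1 := by
  classical
  have : indepSetsIn G (∅ : Finset V) = {∅} := by
    ext I
    simp +contextual [mem_indepSetsIn]
  simp [partitionIn, this]

theorem partitionIn_mono (hlam : 0 ≤ lam) {S T : Finset V} (h : S ⊆ T) :
    partitionIn G lam S ≤ partitionIn G lam T :=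
  Finset.sum_le_sum_of_subset_of_nonneg (indepSetsIn_mono h) fun _ _ _ => by positivity

theorem partitionIn_pos (hlam : 0 ≤ lam) (S : Finset V) : 0 < partitionIn G lam S := by
  have := partitionIn_mono (G := G) hlam (Finset.empty_subset S)
  rw [partitionIn_empty] at this
  linarith

theorem occupiedWeight_of_notMem {S : Finset V} {v : V} (hv : v ∉ S) :
    occupiedWeight G lam S v = 0 := by
  classical
  refine Finset.sum_eq_zero fun I hI => ?_
  rw [Finset.mem_filter, mem_indepSetsIn] at hI
  exact absurd (hI.1.1 hI.2) hv

theorem occupiedWeight_nonneg (hlam : 0 ≤ lam) (S : Finset V) (v : V) :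
    0 ≤ occupiedWeight G lam S v :=
  Finset.sum_nonneg fun _ _ => by positivity

open Classical in
theorem occupiedWeight_eq_mul {S : Finset V} {v : V} (hv : v ∈ S) :
    occupiedWeight G lam S v =
      lam * partitionIn G lam (S.filter fun w => w ≠ v ∧ ¬ G.Adj v w) := by
  rw [occupiedWeight, partitionIn, Finset.mul_sum]
  refine Finset.sum_bij' (fun I _ => I.erase v) (fun I _ => insert v I) ?_ ?_ ?_ ?_ ?_
  · intro I hI
    rw [Finset.mem_filter, mem_indepSetsIn] at hI
    rw [mem_indepSetsIn]
    refine ⟨fun w hw => ?_, fun a ha b hb => hI.1.2 a (Finset.mem_of_mem_erase ha) b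
      (Finset.mem_of_mem_erase hb)⟩
    rw [Finset.mem_erase] at hw
    exact Finset.mem_filter.2 ⟨hI.1.1 hw.2, hw.1, hI.1.2 v hI.2 w hw.2⟩
  · intro I hI
    rw [mem_indepSetsIn] at hI
    have hI1 : ∀ w ∈ I, w ∈ S ∧ w ≠ v ∧ ¬ G.Adj v w := fun w hw => Finset.mem_filter.1 (hI.1 hw)
    rw [Finset.mem_filter, mem_indepSetsIn]
    refine ⟨⟨?_, ?_⟩, Finset.mem_insert_self _ _⟩
    · intro w hw
      rcases Finset.mem_insert.1 hw with rfl | hw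
      · exact hv
      · exact (hI1 w hw).1
    · intro a ha b hb
      rcases Finset.mem_insert.1 ha with rfl | ha'
      · rcases Finset.mem_insert.1 hb with rfl | hb'
        · exact G.irrefl
        · exact (hI1 b hb').2.2
      · rcases Finset.mem_insert.1 hb with rfl | hb'
        · exact fun h => (hI1 a ha').2.2 h.symm
        · exact hI.2 a ha' b hb'
  · intro I hI
    exact Finset.insert_erase (Finset.mem_filter.1 hI).2
  · intro I hI
    rw [mem_indepSetsIn] at hI
    refine Finset.erase_insert fun hvI => ?_
    exact (Finset.mem_filter.1 (hI.1 hvI)).2.1 rfl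
  · intro I hI
    rw [← pow_succ', Finset.card_erase_add_one (Finset.mem_filter.1 hI).2]

theorem occupiedWeight_pos (hlam : 0 < lam) {S : Finset V} {v : V} (hv : v ∈ S) :
    0 < occupiedWeight G lam S v := by
  classical
  rw [occupiedWeight_eq_mul hv]
  exact mul_pos hlam (partitionIn_pos hlam.le _)

open Classical in
theorem partitionIn_eq_erase_add (S : Finset V) (v : V) :
    partitionIn G lam S = partitionIn G lam (S.erase v) + occupiedWeight G lam S v := by
  rw [partitionIn, ← Finset.sum_filter_add_sum_filter_not _ (fun I => v ∈ I), add_comm,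
    occupiedWeight, partitionIn]
  congr 1
  refine Finset.sum_congr ?_ fun _ _ => rfl
  ext I
  simp only [Finset.mem_filter, mem_indepSetsIn, Finset.subset_erase]
  tauto

open Classical in
theorem partitionIn_union_le (hlam : 0 ≤ lam) (T R : Finset V) :
    partitionIn G lam (T ∪ R) ≤ (1 + lam) ^ R.card * partitionIn G lam T := by
  induction R using Finset.induction_on with
  | empty => simp
  | insert v R hv ih =>
    have hle : partitionIn G lam ((T ∪ insert v R).erase v) ≤ partitionIn G lam (T ∪ R) := by
      refine partitionIn_mono hlam fun w hw => ?_
      simp only [Finset.mem_erase, Finset.mem_union, Finset.mem_insert] at hw ⊢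
      tauto
    have hocc : occupiedWeight G lam (T ∪ insert v R) v ≤ lam * partitionIn G lam (T ∪ R) := by
      rw [occupiedWeight_eq_mul (by simp)]
      refine mul_le_mul_of_nonneg_left (partitionIn_mono hlam fun w hw => ?_) hlam
      simp only [Finset.mem_filter, Finset.mem_union, Finset.mem_insert] at hw ⊢
      tauto
    calc partitionIn G lam (T ∪ insert v R) ≤ (1 + lam) * partitionIn G lam (T ∪ R) := by
          rw [partitionIn_eq_erase_add _ v]; linarith
      _ ≤ (1 + lam) * ((1 + lam) ^ R.card * partitionIn G lam T) := by gcongr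
      _ = _ := by rw [Finset.card_insert_of_notMem hv]; ring

theorem partitionIn_le_exp (hlam : 0 ≤ lam) (S : Finset V) :
    partitionIn G lam S ≤ Real.exp (lam * S.card) := by
  classical
  have h := partitionIn_union_le (G := G) hlam ∅ S
  rw [Finset.empty_union, partitionIn_empty, mul_one] at h
  refine h.trans ?_
  rw [mul_comm, Real.exp_nat_mul]
  gcongr
  linarith [Real.add_one_le_exp lam]

open Classical in
/-- A vertex is occupied with probability at least `lam / (1 + lam) ^ (d + 1)`, where `d` is its
degree; the stated bound is a linear lower estimate for this power. -/
theorem le_occupiedWeight (hlam : 0 ≤ lam) {S : Finset V} {v : V} (hv : v ∈ S) :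
    lam * (1 - lam * ((S.filter (G.Adj v)).card + 1)) * partitionIn G lam S ≤
      occupiedWeight G lam S v := by
  set d := (S.filter (G.Adj v)).card
  set Z := partitionIn G lam (S.filter fun w => w ≠ v ∧ ¬ G.Adj v w) with hZ
  have hZ0 : 0 < Z := partitionIn_pos hlam _
  have hcard : (insert v (S.filter (G.Adj v))).card = d + 1 :=
    Finset.card_insert_of_notMem (by simp)
  have hS : (S.filter fun w => w ≠ v ∧ ¬ G.Adj v w) ∪ insert v (S.filter (G.Adj v)) = S := by
    ext w
    simp only [Finset.mem_union, Finset.mem_filter, Finset.mem_insert]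
    constructor
    · rintro (h | rfl | h)
      exacts [h.1, hv, h.1]
    · intro h
      tauto
  have h1 := partitionIn_union_le (G := G) hlam (S.filter fun w => w ≠ v ∧ ¬ G.Adj v w)
    (insert v (S.filter (G.Adj v)))
  rw [hS, hcard, ← hZ] at h1
  rw [occupiedWeight_eq_mul hv, ← hZ, mul_assoc]
  refine mul_le_mul_of_nonneg_left ?_ hlam
  have hP := partitionIn_pos (G := G) hlam S
  by_cases hneg : 1 - lam * ((d : ℝ) + 1) ≤ 0
  · nlinarith
  · push Not at hneg
    have hexp : (1 + lam) ^ (d + 1) ≤ Real.exp (lam * (d + 1)) := by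
      rw [mul_comm, ← Nat.cast_add_one, Real.exp_nat_mul]
      gcongr
      linarith [Real.add_one_le_exp lam]
    have h2 : 1 - lam * ((d : ℝ) + 1) ≤ Real.exp (-(lam * (d + 1))) := by
      linarith [Real.add_one_le_exp (-(lam * ((d : ℝ) + 1)))]
    calc (1 - lam * ((d : ℝ) + 1)) * partitionIn G lam S
        ≤ Real.exp (-(lam * (d + 1))) * (Real.exp (lam * (d + 1)) * Z) := by
          gcongr
          exact h1.trans (by gcongr)
      _ = Z := by rw [← mul_assoc, ← Real.exp_add]; simp

open Classical in
theorem sum_occupiedWeight (S T : Finset V) :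
    ∑ v ∈ T, occupiedWeight G lam S v =
      ∑ I ∈ indepSetsIn G S, lam ^ I.card * ((I ∩ T).card : ℝ) := by
  simp only [occupiedWeight, Finset.sum_filter]
  rw [Finset.sum_comm]
  refine Finset.sum_congr rfl fun I _ => ?_
  rw [← Finset.sum_filter, Finset.sum_const, nsmul_eq_mul, mul_comm, Finset.inter_comm,
    Finset.filter_mem_eq_inter]

/-! ### Local occupancy -/

open Classical in
/-- The vertices of `N` without a neighbour in `A`. -/
noncomputable def uncovered (G : SimpleGraph V) (N A : Finset V) : Finset V :=
  N.filter fun w => ∀ a ∈ A, ¬ G.Adj a w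

open Classical in
/-- An independent set is revealed in two stages, first outside `N`, then among the vertices
of `N` that remain available: the spatial Markov property of the hard-core model. -/
theorem sum_indepSetsIn_eq {S N : Finset V} (hN : N ⊆ S) (g : Finset V → ℝ) :
    ∑ I ∈ indepSetsIn G S, g I =
      ∑ A ∈ indepSetsIn G (S \ N), ∑ B ∈ indepSetsIn G (uncovered G N A), g (A ∪ B) := by
  rw [Finset.sum_sigma']
  refine Finset.sum_bij' (fun I _ => ⟨I \ N, I ∩ N⟩) (fun p _ => p.1 ∪ p.2) ?_ ?_ ?_ ?_ ?_
  · intro I hI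
    rw [mem_indepSetsIn] at hI
    simp only [Finset.mem_sigma, mem_indepSetsIn]
    refine ⟨⟨Finset.sdiff_subset_sdiff hI.1 le_rfl, fun a ha b hb => ?_⟩, fun w hw => ?_,
      fun a ha b hb => ?_⟩
    · exact hI.2 a (Finset.mem_sdiff.1 ha).1 b (Finset.mem_sdiff.1 hb).1
    · rw [Finset.mem_inter] at hw
      exact Finset.mem_filter.2 ⟨hw.2, fun a ha => hI.2 a (Finset.mem_sdiff.1 ha).1 w hw.1⟩
    · exact hI.2 a (Finset.mem_inter.1 ha).1 b (Finset.mem_inter.1 hb).1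
  · rintro ⟨A, B⟩ h
    simp only [Finset.mem_sigma, mem_indepSetsIn] at h
    obtain ⟨⟨hA, hA'⟩, hB, hB'⟩ := h
    have hB1 : ∀ b ∈ B, b ∈ N ∧ ∀ a ∈ A, ¬ G.Adj a b := fun b hb => Finset.mem_filter.1 (hB hb)
    rw [mem_indepSetsIn]
    refine ⟨Finset.union_subset (hA.trans Finset.sdiff_subset)
      fun b hb => hN (hB1 b hb).1, fun a ha b hb => ?_⟩
    rcases Finset.mem_union.1 ha with ha | ha <;> rcases Finset.mem_union.1 hb with hb | hb
    · exact hA' a ha b hb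
    · exact (hB1 b hb).2 a ha
    · exact fun h => (hB1 a ha).2 b hb h.symm
    · exact hB' a ha b hb
  · intro I _
    exact Finset.sdiff_union_inter I N
  · rintro ⟨A, B⟩ h
    simp only [Finset.mem_sigma, mem_indepSetsIn] at h
    obtain ⟨⟨hA, -⟩, hB, -⟩ := h
    have hA1 : ∀ a ∈ A, a ∉ N := fun a ha => (Finset.mem_sdiff.1 (hA ha)).2
    have hB1 : ∀ b ∈ B, b ∈ N := fun b hb => (Finset.mem_filter.1 (hB hb)).1
    have e1 : (A ∪ B) \ N = A := by
      ext x
      simp only [Finset.mem_sdiff, Finset.mem_union]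
      have := hA1 x; have := hB1 x; tauto
    have e2 : (A ∪ B) ∩ N = B := by
      ext x
      simp only [Finset.mem_inter, Finset.mem_union]
      have := hA1 x; have := hB1 x; tauto
    simp only [e1, e2]
  · intro I _
    simp only [Finset.sdiff_union_inter]

open Classical in
/-- Local occupancy: an inequality about the hard-core models inside the neighbourhood of `u`
gives a lower bound on a combination of the occupancy of `u` and of its neighbours. -/
theorem partitionIn_le_of_neighborhood (hlam : 0 < lam) {β γ : ℝ} {S : Finset V} {u : V}
    (hu : u ∈ S)
    (hF : ∀ F ⊆ S.filter (G.Adj u), partitionIn G lam F ≤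
      β * (lam / (1 + lam)) + γ * ∑ v ∈ F, occupiedWeight G lam F v) :
    partitionIn G lam S ≤ β * occupiedWeight G lam S u +
      γ * ∑ v ∈ S.filter (G.Adj u), occupiedWeight G lam S v := by
  set N := S.filter (G.Adj u) with hNdef
  have hNS : N ⊆ S := Finset.filter_subset _ _
  have huN : u ∉ N := by simp [hNdef]
  have hdisj : ∀ A ∈ indepSetsIn G (S \ N), ∀ B ∈ indepSetsIn G (uncovered G N A),
      Disjoint A B ∧ B ⊆ N := by
    intro A hA B hB
    rw [mem_indepSetsIn] at hA hB
    have hBN : B ⊆ N := hB.1.trans (Finset.filter_subset _ _)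
    refine ⟨?_, hBN⟩
    rw [Finset.disjoint_left]
    exact fun a ha hb => (Finset.mem_sdiff.1 (hA.1 ha)).2 (hBN hb)
  have hZ : partitionIn G lam S =
      ∑ A ∈ indepSetsIn G (S \ N), lam ^ A.card * partitionIn G lam (uncovered G N A) := by
    rw [partitionIn, sum_indepSetsIn_eq hNS]
    refine Finset.sum_congr rfl fun A hA => ?_
    rw [partitionIn, Finset.mul_sum]
    refine Finset.sum_congr rfl fun B hB => ?_
    rw [Finset.card_union_of_disjoint (hdisj A hA B hB).1, pow_add]
  have hsum : ∑ v ∈ N, occupiedWeight G lam S v = ∑ A ∈ indepSetsIn G (S \ N),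
      lam ^ A.card * ∑ v ∈ uncovered G N A, occupiedWeight G lam (uncovered G N A) v := by
    rw [sum_occupiedWeight, sum_indepSetsIn_eq hNS]
    refine Finset.sum_congr rfl fun A hA => ?_
    rw [sum_occupiedWeight, Finset.mul_sum]
    refine Finset.sum_congr rfl fun B hB => ?_
    obtain ⟨h1, h2⟩ := hdisj A hA B hB
    have e1 : (A ∪ B) ∩ N = B := by
      ext x
      simp only [Finset.mem_inter, Finset.mem_union]
      have := @h2 x
      have hx : x ∈ A → x ∉ N := fun hx =>
        (Finset.mem_sdiff.1 ((mem_indepSetsIn.1 hA).1 hx)).2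
      tauto
    rw [Finset.card_union_of_disjoint h1, pow_add, e1,
      Finset.inter_eq_left.2 (mem_indepSetsIn.1 hB).1, mul_assoc]
  -- Once `u` is occupied, no vertex of `N` is available.
  have hocc : occupiedWeight G lam S u = occupiedWeight G lam (S \ N) u := by
    rw [occupiedWeight, Finset.sum_filter, sum_indepSetsIn_eq hNS, occupiedWeight,
      Finset.sum_filter]
    refine Finset.sum_congr rfl fun A hA => ?_
    by_cases huA : u ∈ A
    · have hemp : uncovered G N A = ∅ := by
        refine Finset.filter_eq_empty_iff.2 fun w hw h => h u huA ?_
        exact (Finset.mem_filter.1 hw).2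
      have : indepSetsIn G (∅ : Finset V) = {∅} := by
        ext I
        simp +contextual [mem_indepSetsIn]
      simp [hemp, this, huA]
    · rw [if_neg huA]
      refine Finset.sum_eq_zero fun B hB => if_neg ?_
      rw [Finset.mem_union]
      exact fun h => h.elim huA fun h => huN ((hdisj A hA B hB).2 h)
  -- Outside `N` the vertex `u` is isolated, so it is occupied with odds `lam`.
  have hiso : occupiedWeight G lam (S \ N) u =
      lam / (1 + lam) * partitionIn G lam (S \ N) := by
    have huSN : u ∈ S \ N := Finset.mem_sdiff.2 ⟨hu, huN⟩
    have e : ((S \ N).filter fun w => w ≠ u ∧ ¬ G.Adj u w) = (S \ N).erase u := by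
      ext x
      simp only [hNdef, Finset.mem_filter, Finset.mem_sdiff, Finset.mem_erase]
      tauto
    have h1 := occupiedWeight_eq_mul (G := G) (lam := lam) huSN
    have h2 := partitionIn_eq_erase_add (G := G) (lam := lam) (S \ N) u
    rw [e] at h1
    have : (1 + lam) ≠ 0 := by positivity
    field_simp
    linear_combination h1 - lam * h2
  rw [hocc, hiso, hZ, hsum, partitionIn, Finset.mul_sum, Finset.mul_sum, Finset.mul_sum,
    ← Finset.sum_add_distrib]
  refine Finset.sum_le_sum fun A _ => ?_
  have := hF (uncovered G N A) (Finset.filter_subset _ _)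
  calc lam ^ A.card * partitionIn G lam (uncovered G N A)
      ≤ lam ^ A.card * (β * (lam / (1 + lam)) +
        γ * ∑ v ∈ uncovered G N A, occupiedWeight G lam (uncovered G N A) v) := by gcongr
    _ = _ := by ring

end Subsets

/-! ### Sparsity of neighbourhoods in graphs without a `k`-cycle -/

section Sparsity

variable {V : Type*} {G : SimpleGraph V}

open Classical in
theorem exists_isPath_of_le_degree {F : Finset V} (hF : F.Nonempty) {m : ℕ}
    (hdeg : ∀ v ∈ F, m ≤ (F.filter (G.Adj v)).card) :
    ∃ (a b : V) (p : G.Walk a b), p.IsPath ∧ p.length = m ∧ ∀ x ∈ p.support, x ∈ F := by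
  suffices H : ∀ n ≤ m, ∃ (a b : V) (p : G.Walk a b),
      p.IsPath ∧ p.length = n ∧ ∀ x ∈ p.support, x ∈ F from H m le_rfl
  intro n
  induction n with
  | zero =>
    obtain ⟨v, hv⟩ := hF
    exact fun _ => ⟨v, v, .nil, by simp, rfl, by simpa using hv⟩
  | succ n ih =>
    intro hn
    obtain ⟨a, b, p, hp, hlen, hsupp⟩ := ih (by omega)
    -- The path has at most `n` vertices besides `a`, so `a` has a neighbour off the path.
    have hcard : (p.support.toFinset.erase a).card < (F.filter (G.Adj a)).card := by
      have h1 : p.support.toFinset.card ≤ n + 1 := by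
        simpa [hlen] using p.support.toFinset_card_le
      have h2 := hdeg a (hsupp a p.start_mem_support)
      rw [Finset.card_erase_of_mem (by simp)]
      omega
    obtain ⟨y, hy, hyp⟩ := Finset.exists_mem_notMem_of_card_lt_card hcard
    rw [Finset.mem_filter] at hy
    have hyp' : y ∉ p.support := fun h =>
      hyp (Finset.mem_erase.2 ⟨hy.2.ne', List.mem_toFinset.2 h⟩)
    refine ⟨y, b, .cons hy.2.symm p, ?_, by simp [hlen], ?_⟩
    · exact (SimpleGraph.Walk.cons_isPath_iff _ _).2 ⟨hp, hyp'⟩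
    · intro x hx
      rw [SimpleGraph.Walk.support_cons, List.mem_cons] at hx
      rcases hx with rfl | hx
      exacts [hy.1, hsupp x hx]

open Classical in
/-- A path on `k - 1` vertices among the neighbours of `u` would close up to a `k`-cycle
through `u`. -/
theorem exists_degree_lt_of_cycleGraph_free {k : ℕ} (hk : 3 ≤ k)
    (hfree : (SimpleGraph.cycleGraph k).Free G) {u : V} {F : Finset V} (hF : F.Nonempty)
    (hFu : ∀ v ∈ F, G.Adj u v) : ∃ v ∈ F, (F.filter (G.Adj v)).card < k - 2 := by
  by_contra! hdeg
  obtain ⟨a, b, p, hp, hlen, hsupp⟩ := exists_isPath_of_le_degree hF hdeg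
  have hup : u ∉ p.support := fun h => G.irrefl (hFu u (hsupp u h))
  have hua := hFu a (hsupp a p.start_mem_support)
  have hub := hFu b (hsupp b p.end_mem_support)
  have hab : b ≠ a := by
    rintro rfl
    have := SimpleGraph.Walk.length_eq_zero_iff.2 (SimpleGraph.Walk.isPath_iff_nil.1 hp)
    omega
  refine hfree ((SimpleGraph.cycleGraph_isContained_iff (by omega)).2
    ⟨u, .cons hua (p.concat hub.symm), ?_, ?_⟩)
  · rw [SimpleGraph.Walk.cons_isCycle_iff]
    refine ⟨hp.concat hup hub.symm, ?_⟩
    rw [SimpleGraph.Walk.edges_concat]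
    simp only [List.concat_eq_append, List.mem_append, List.mem_singleton, not_or]
    refine ⟨fun h => hup (p.fst_mem_support_of_mem_edges h), fun h => ?_⟩
    rw [Sym2.eq_swap, Sym2.congr_left] at h
    exact hab h.symm
  · simp [hlen]
    omega

open Classical in
/-- The degree sum of a degenerate graph is small: remove the vertices one by one. -/
theorem sum_degree_le_of_degenerate {m : ℕ} (F : Finset V)
    (h : ∀ F' ⊆ F, F'.Nonempty → ∃ v ∈ F', (F'.filter (G.Adj v)).card ≤ m) :
    ∑ v ∈ F, (F.filter (G.Adj v)).card ≤ 2 * m * F.card := by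
  induction F using Finset.strongInduction with
  | H F ih =>
    rcases F.eq_empty_or_nonempty with rfl | hF
    · simp
    obtain ⟨v, hv, hdeg⟩ := h F le_rfl hF
    have ih' := ih (F.erase v) (Finset.erase_ssubset hv)
      fun F' hF' => h F' (hF'.trans (Finset.erase_subset _ _))
    have hstep : ∀ w ∈ F.erase v, (F.filter (G.Adj w)).card =
        ((F.erase v).filter (G.Adj w)).card + if G.Adj v w then 1 else 0 := by
      intro w _
      rw [Finset.filter_erase]
      split_ifs with hvw
      · rw [Finset.card_erase_add_one (Finset.mem_filter.2 ⟨hv, hvw.symm⟩)]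
      · rw [Finset.erase_eq_of_notMem fun hmem => hvw (Finset.mem_filter.1 hmem).2.symm, add_zero]
    have hcount : ∑ w ∈ F.erase v, (if G.Adj v w then 1 else 0) = (F.filter (G.Adj v)).card := by
      rw [← Finset.card_filter, Finset.filter_erase, Finset.erase_eq_of_notMem (by simp)]
    rw [← Finset.add_sum_erase _ _ hv, Finset.sum_congr rfl hstep, Finset.sum_add_distrib, hcount,
      ← Finset.card_erase_add_one hv, mul_add]
    omega

end Sparsity

/-! ### Choice of parameters -/

section Parameters

variable {V : Type*} {G : SimpleGraph V}

open Classical in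
theorem le_sum_occupiedWeight {lam : ℝ} (hlam : 0 ≤ lam) {F : Finset V} {m : ℕ}
    (hdeg : ∑ v ∈ F, (F.filter (G.Adj v)).card ≤ 2 * m * F.card) :
    lam * (1 - lam * (2 * m + 1)) * F.card * partitionIn G lam F ≤
      ∑ v ∈ F, occupiedWeight G lam F v := by
  have hdeg' : ∑ v ∈ F, ((F.filter (G.Adj v)).card : ℝ) ≤ 2 * m * F.card := by exact_mod_cast hdeg
  have hP := partitionIn_pos (G := G) hlam F
  refine le_trans ?_ (Finset.sum_le_sum fun v hv => le_occupiedWeight hlam hv)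
  rw [← Finset.sum_mul, ← Finset.mul_sum, Finset.sum_sub_distrib, ← Finset.mul_sum,
    Finset.sum_add_distrib]
  simp only [Finset.sum_const, nsmul_eq_mul, mul_one]
  rw [mul_assoc lam]
  refine mul_le_mul_of_nonneg_right (mul_le_mul_of_nonneg_left ?_ hlam) hP.le
  nlinarith [mul_le_mul_of_nonneg_left hdeg' hlam]

/-- The local inequality for a sparse graph on `F`. With `y = lam * F.card` the partition
function is at most `exp y`, and the claim reduces to `(L - y) * exp y ≤ exp L`. -/
theorem partitionIn_le_of_sparse {lam : ℝ} (hlam : 0 ≤ lam) {F : Finset V} {η L : ℝ} (hη : η < 1)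
    (hL : 0 < L)
    (hocc : lam * (1 - η) * F.card * partitionIn G lam F ≤ ∑ v ∈ F, occupiedWeight G lam F v) :
    partitionIn G lam F ≤
      Real.exp L / L + 1 / (L * (1 - η)) * ∑ v ∈ F, occupiedWeight G lam F v := by
  have hη' : 0 < 1 - η := by linarith
  set y := lam * F.card with hy
  have hZ := partitionIn_le_exp (G := G) hlam F
  have hP := partitionIn_pos (G := G) hlam F
  set Z := partitionIn G lam F
  have hkey : (L - y) * Z ≤ Real.exp L := by
    rcases le_total (L - y) 0 with h | h
    · exact (mul_nonpos_of_nonpos_of_nonneg h hP.le).trans (Real.exp_pos _).le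
    · calc (L - y) * Z ≤ Real.exp (L - y) * Real.exp y := by
            gcongr
            linarith [Real.add_one_le_exp (L - y)]
        _ = Real.exp L := by rw [← Real.exp_add]; ring_nf
  have h2 : y * Z / L ≤ 1 / (L * (1 - η)) * ∑ v ∈ F, occupiedWeight G lam F v := by
    calc y * Z / L = 1 / (L * (1 - η)) * (lam * (1 - η) * F.card * Z) := by
          rw [hy]; field_simp
      _ ≤ _ := by gcongr
  have h3 : Z = (L - y) * Z / L + y * Z / L := by field_simp; ring
  calc Z = (L - y) * Z / L + y * Z / L := h3
    _ ≤ _ := by gcongr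

open Classical in
/-- Local occupancy in a graph without a `k`-cycle, at fugacity `η / (2 * k)`. -/
theorem localOccupancy_of_cycleGraph_free {k : ℕ} (hk : 3 ≤ k)
    (hfree : (SimpleGraph.cycleGraph k).Free G) {η L lam : ℝ} (hη0 : 0 < η) (hη : η < 1)
    (hL : 0 < L) (hlam : lam = η / (2 * k)) (S : Finset V) {u : V} (hu : u ∈ S) :
    partitionIn G lam S ≤
      (1 + lam) / lam * (Real.exp L / L) * occupiedWeight G lam S u +
        1 / (L * (1 - η)) * ∑ v ∈ S.filter (G.Adj u), occupiedWeight G lam S v := by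
  have hk0 : (0 : ℝ) < k := by positivity
  have hlam0 : 0 < lam := by rw [hlam]; positivity
  refine partitionIn_le_of_neighborhood hlam0 hu fun F hF => ?_
  have hFu : ∀ v ∈ F, G.Adj u v := fun v hv => (Finset.mem_filter.1 (hF hv)).2
  have hdeg := sum_degree_le_of_degenerate (G := G) (m := k - 2) F fun F' hF' hne => by
    obtain ⟨v, hv, h⟩ := exists_degree_lt_of_cycleGraph_free hk hfree hne
      fun v hv => hFu v (hF' hv)
    exact ⟨v, hv, h.le⟩
  have hocc : lam * (1 - η) * F.card * partitionIn G lam F ≤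
      ∑ v ∈ F, occupiedWeight G lam F v := by
    refine le_trans ?_ (le_sum_occupiedWeight hlam0.le hdeg)
    have hP := partitionIn_pos (G := G) hlam0.le F
    have hm : ((k - 2 : ℕ) : ℝ) = k - 2 := by
      rw [Nat.cast_sub (by omega)]; norm_num
    have hle : lam * (2 * ((k - 2 : ℕ) : ℝ) + 1) ≤ η := by
      calc lam * (2 * ((k - 2 : ℕ) : ℝ) + 1) ≤ lam * (2 * k) := by
            rw [hm]; gcongr; linarith
        _ = η := by rw [hlam]; field_simp
    gcongr
  refine (partitionIn_le_of_sparse hlam0.le hη hL hocc).trans_eq ?_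
  congr 1
  field_simp

/-- With `η` small and `ρ` large, `L = log (η ^ 2 * ρ)` is close enough to `log ρ`. -/
theorem exists_parameters {lam ε : ℝ} (hlam : 0 < lam) (hε : 0 < ε) :
    ∃ η R : ℝ, 0 < η ∧ η < 1 ∧ η ≤ lam ∧ 0 < R ∧ ∀ ρ ≥ R, 0 < Real.log ρ ∧
      0 < Real.log (η ^ 2 * ρ) ∧
        (4 * η + 1 / (1 - η)) / Real.log (η ^ 2 * ρ) ≤ (1 + ε) / Real.log ρ := by
  have hcont : ContinuousAt (fun η : ℝ => 4 * η + 1 / (1 - η)) 0 := by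
    refine ContinuousAt.add (by fun_prop) (ContinuousAt.div (by fun_prop) (by fun_prop) (by simp))
  have hev : ∀ᶠ η : ℝ in 𝓝[>] 0, 4 * η + 1 / (1 - η) < 1 + ε / 2 := by
    refine nhdsWithin_le_nhds (hcont.eventually_lt continuousAt_const ?_)
    simp [hε]
  obtain ⟨η, h1, h2, h3⟩ := (hev.and (Ioo_mem_nhdsGT (lt_min one_pos hlam))).exists
  have hη1 : η < 1 := h3.trans_le (min_le_left _ _)
  set c := Real.log (η ^ 2) with hc
  have hevR : ∀ᶠ ρ : ℝ in atTop, 0 < ρ ∧ max 0 (max (-c) (-(c * (1 + ε) / (ε / 2)))) < Real.log ρ :=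
    (eventually_gt_atTop 0).and (Real.tendsto_log_atTop.eventually_gt_atTop _)
  obtain ⟨R, hR⟩ := eventually_atTop.1 hevR
  refine ⟨η, max R 1, h2, hη1, (h3.trans_le (min_le_right _ _)).le, by positivity, fun ρ hρ => ?_⟩
  obtain ⟨hρ0, hρlog⟩ := hR ρ ((le_max_left _ _).trans hρ)
  rw [max_lt_iff, max_lt_iff] at hρlog
  obtain ⟨l1, l2, l3⟩ := hρlog
  have hlog : Real.log (η ^ 2 * ρ) = c + Real.log ρ := Real.log_mul (by positivity) hρ0.ne'
  have hL : 0 < Real.log (η ^ 2 * ρ) := by rw [hlog]; linarith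
  refine ⟨l1, hL, ?_⟩
  rw [div_le_div_iff₀ hL l1]
  refine (mul_le_mul_of_nonneg_right h1.le l1.le).trans ?_
  rw [hlog]
  rw [← neg_div, div_lt_iff₀ (by positivity)] at l3
  linarith

/-- Pointwise properties that hold eventually for each fixed `ε > 0` hold eventually along
some `ε` tending to zero. -/
theorem exists_tendsto_zero_eventually {P : ℝ → ℕ → Prop}
    (h : ∀ ε > 0, ∀ᶠ n in atTop, P ε n) :
    ∃ e : ℕ → ℝ, Tendsto e atTop (𝓝 0) ∧ ∀ᶠ n in atTop, P (e n) n := by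
  classical
  have h' : ∀ i : ℕ, ∃ N, ∀ n ≥ N, P (1 / ((i : ℝ) + 1)) n := fun i =>
    eventually_atTop.1 (h _ (by positivity))
  choose N hN using h'
  set φ : ℕ → ℕ := fun n => Nat.findGreatest (fun i => N i ≤ n) n with hφ
  refine ⟨fun n => 1 / ((φ n : ℝ) + 1), ?_, ?_⟩
  · refine tendsto_one_div_add_atTop_nhds_zero_nat.comp (tendsto_atTop.2 fun i => ?_)
    filter_upwards [eventually_ge_atTop i, eventually_ge_atTop (N i)] with n h1 h2
    exact Nat.le_findGreatest h1 h2
  · filter_upwards [eventually_ge_atTop (N 0)] with n hn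
    exact hN _ _ (Nat.findGreatest_spec (P := fun i => N i ≤ n) (Nat.zero_le n) hn)

end Parameters

/-! ### From local occupancy to the occupancy fraction and fractional colourings -/

section Global

variable {V : Type*} [Fintype V] {G : SimpleGraph V} {lam : ℝ}

theorem indepSetsIn_univ : indepSetsIn G Finset.univ = indepSets G := by
  classical
  simp only [indepSetsIn, indepSets, Finset.powerset_univ]

theorem indepSetsIn_subset_indepSets (S : Finset V) : indepSetsIn G S ⊆ indepSets G := by
  rw [← indepSetsIn_univ]
  exact indepSetsIn_mono (Finset.subset_univ S)

theorem partitionFunction_pos (hlam : 0 ≤ lam) : 0 < partitionFunction G lam := by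
  rw [partitionFunction, ← indepSetsIn_univ]
  exact partitionIn_pos hlam _

theorem expectedSize_eq : expectedSize G lam =
    (∑ I ∈ indepSets G, lam ^ I.card * (I.card : ℝ)) / partitionFunction G lam := by
  simp only [expectedSize, prob]
  rw [Finset.sum_div]
  exact Finset.sum_congr rfl fun I _ => by ring

/-- The occupancy fraction increases with the fugacity: with `I` and `J` weighted by the two
fugacities, the difference is a symmetrised sum of nonnegative terms. -/
theorem expectedSize_mono {μ : ℝ} (hμ : 0 < μ) (hμlam : μ ≤ lam) :
    expectedSize G μ ≤ expectedSize G lam := by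
  have hlam : 0 < lam := hμ.trans_le hμlam
  rw [expectedSize_eq, expectedSize_eq,
    div_le_div_iff₀ (partitionFunction_pos hμ.le) (partitionFunction_pos hlam.le)]
  simp only [partitionFunction, Finset.sum_mul_sum]
  set T := indepSets G
  have hterm : ∀ a b : ℕ, 0 ≤ ((a : ℝ) - b) * (lam ^ a * μ ^ b - lam ^ b * μ ^ a) := by
    have key : ∀ a b : ℕ, b ≤ a → 0 ≤ ((a : ℝ) - b) * (lam ^ a * μ ^ b - lam ^ b * μ ^ a) := by
      intro a b hab
      have h1 : (b : ℝ) ≤ a := by exact_mod_cast hab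
      refine mul_nonneg (by linarith) (sub_nonneg.2 ?_)
      obtain ⟨c, rfl⟩ := Nat.exists_eq_add_of_le hab
      calc lam ^ b * μ ^ (b + c) = lam ^ b * μ ^ b * μ ^ c := by ring
        _ ≤ lam ^ b * μ ^ b * lam ^ c := by gcongr
        _ = lam ^ (b + c) * μ ^ b := by ring
    intro a b
    rcases le_total b a with hab | hab
    · exact key a b hab
    · have := key b a hab
      linarith
  have hnonneg : 0 ≤ ∑ I ∈ T, ∑ J ∈ T, ((I.card : ℝ) - J.card) *
      (lam ^ I.card * μ ^ J.card - lam ^ J.card * μ ^ I.card) :=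
    Finset.sum_nonneg fun I _ => Finset.sum_nonneg fun J _ => hterm _ _
  have hexpand : ∑ I ∈ T, ∑ J ∈ T, ((I.card : ℝ) - J.card) *
      (lam ^ I.card * μ ^ J.card - lam ^ J.card * μ ^ I.card) =
      (∑ I ∈ T, ∑ J ∈ T, lam ^ I.card * I.card * μ ^ J.card -
        ∑ I ∈ T, ∑ J ∈ T, μ ^ I.card * I.card * lam ^ J.card) +
      (∑ I ∈ T, ∑ J ∈ T, lam ^ J.card * J.card * μ ^ I.card -
        ∑ I ∈ T, ∑ J ∈ T, μ ^ J.card * J.card * lam ^ I.card) := by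
    simp only [← Finset.sum_sub_distrib, ← Finset.sum_add_distrib]
    exact Finset.sum_congr rfl fun I _ => Finset.sum_congr rfl fun J _ => by ring
  rw [hexpand, Finset.sum_comm (f := fun I J : Finset V => lam ^ J.card * J.card * μ ^ I.card),
    Finset.sum_comm (f := fun I J : Finset V => μ ^ J.card * J.card * lam ^ I.card)] at hnonneg
  linarith

open Classical in
theorem one_div_le_occupancyFraction [Nonempty V] (hlam : 0 < lam) {β γ : ℝ} {Δ : ℕ}
    (hγ : 0 ≤ γ) (hpos : 0 < β + γ * Δ)
    (hdeg : ∀ v, (Finset.univ.filter (G.Adj v)).card ≤ Δ)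
    (hloc : ∀ u, partitionIn G lam Finset.univ ≤ β * occupiedWeight G lam Finset.univ u +
      γ * ∑ v ∈ Finset.univ.filter (G.Adj u), occupiedWeight G lam Finset.univ v) :
    1 / (β + γ * Δ) ≤ occupancyFraction G lam := by
  set q := occupiedWeight G lam Finset.univ with hq
  have hsumq : ∑ v, q v = ∑ I ∈ indepSets G, lam ^ I.card * (I.card : ℝ) := by
    rw [hq, sum_occupiedWeight, indepSetsIn_univ]
    simp
  have hZ : partitionIn G lam Finset.univ = partitionFunction G lam := by
    rw [partitionIn, indepSetsIn_univ, partitionFunction]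
  have hZ0 := partitionFunction_pos (G := G) hlam.le
  have hdouble : ∑ u, ∑ v ∈ Finset.univ.filter (G.Adj u), q v ≤ Δ * ∑ v, q v := by
    simp only [Finset.sum_filter]
    rw [Finset.sum_comm, Finset.mul_sum]
    refine Finset.sum_le_sum fun v _ => ?_
    rw [← Finset.sum_filter, Finset.sum_const, nsmul_eq_mul]
    refine mul_le_mul_of_nonneg_right ?_ (occupiedWeight_nonneg hlam.le _ _)
    simp only [G.adj_comm _ v]
    exact_mod_cast hdeg v
  have hmain : (Fintype.card V : ℝ) * partitionFunction G lam ≤ (β + γ * Δ) * ∑ v, q v := by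
    have := Finset.sum_le_sum fun u (_ : u ∈ Finset.univ) => hloc u
    rw [Finset.sum_add_distrib, ← Finset.mul_sum, ← Finset.mul_sum, Finset.sum_const, nsmul_eq_mul,
      Finset.card_univ, hZ] at this
    nlinarith [mul_le_mul_of_nonneg_left hdouble hγ]
  have hn : (0 : ℝ) < Fintype.card V := by exact_mod_cast Fintype.card_pos
  rw [occupancyFraction, expectedSize_eq, ← hsumq, div_div, div_le_div_iff₀ hpos (by positivity)]
  linarith

open Classical in
/-- Greedy fractional colouring. As long as the residual demand `c` is supported on `S`, colour
with a multiple of the hard-core measure on `S`, just large enough to meet the demand at some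
vertex. By local occupancy each unit of total weight lowers the potential
`β * c u + γ * ∑ c v` of every `u` in the support by at least one. -/
theorem exists_weights_of_localOccupancy (hlam : 0 < lam) {β γ : ℝ} (hβ : 0 ≤ β) (hγ : 0 ≤ γ)
    (hloc : ∀ S : Finset V, ∀ u ∈ S, partitionIn G lam S ≤ β * occupiedWeight G lam S u +
      γ * ∑ v ∈ S.filter (G.Adj u), occupiedWeight G lam S v)
    (S : Finset V) (c : V → ℝ) (M : ℝ) (hM : 0 ≤ M) (hc : ∀ v ∈ S, 0 < c v)
    (hc0 : ∀ v ∉ S, c v = 0)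
    (hpot : ∀ u ∈ S, β * c u + γ * ∑ v ∈ Finset.univ.filter (G.Adj u), c v ≤ M) :
    ∃ w : Finset V → ℝ, (∀ I, 0 ≤ w I) ∧
      (∀ v, ∑ I ∈ (indepSets G).filter (fun I => v ∈ I), w I = c v) ∧
        ∑ I ∈ indepSets G, w I ≤ M := by
  induction S using Finset.strongInduction generalizing c M with
  | H S ih =>
    rcases S.eq_empty_or_nonempty with rfl | hS
    · exact ⟨0, by simp, fun v => by simp [hc0 v], by simpa using hM⟩
    set q := occupiedWeight G lam S with hq
    have hqpos : ∀ v ∈ S, 0 < q v := fun v hv => occupiedWeight_pos hlam hv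
    have hq0 : ∀ v ∉ S, q v = 0 := fun v hv => occupiedWeight_of_notMem hv
    obtain ⟨x, hx, hmin⟩ := S.exists_min_image (fun v => c v / q v) hS
    set τ := c x / q x with hτ
    have hτ0 : 0 < τ := div_pos (hc x hx) (hqpos x hx)
    have hτle : ∀ v, τ * q v ≤ c v := by
      intro v
      by_cases hv : v ∈ S
      · exact (le_div_iff₀ (hqpos v hv)).1 (hmin v hv)
      · rw [hq0 v hv, hc0 v hv, mul_zero]
    have hqsum : ∀ u, ∑ v ∈ S.filter (G.Adj u), q v =
        ∑ v ∈ Finset.univ.filter (G.Adj u), q v := by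
      intro u
      refine Finset.sum_subset (Finset.filter_subset_filter _ (Finset.subset_univ S)) ?_
      intro v hv hvS
      exact hq0 v fun h => hvS (Finset.mem_filter.2 ⟨h, (Finset.mem_filter.1 hv).2⟩)
    have hdrop : ∀ u ∈ S, β * (c u - τ * q u) +
        γ * ∑ v ∈ Finset.univ.filter (G.Adj u), (c v - τ * q v) ≤
          M - τ * partitionIn G lam S := by
      intro u hu
      have h1 := mul_le_mul_of_nonneg_left (hloc S u hu) hτ0.le
      rw [hqsum] at h1
      have h2 := hpot u hu
      rw [Finset.sum_sub_distrib, ← Finset.mul_sum]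
      linarith
    have hM' : 0 ≤ M - τ * partitionIn G lam S := by
      refine le_trans ?_ (hdrop x hx)
      have hnn : ∀ v, 0 ≤ c v - τ * q v := fun v => sub_nonneg.2 (hτle v)
      exact add_nonneg (mul_nonneg hβ (hnn x))
        (mul_nonneg hγ (Finset.sum_nonneg fun v _ => hnn v))
    have hssub : S.filter (fun v => 0 < c v - τ * q v) ⊂ S := by
      refine Finset.filter_ssubset.2 ⟨x, hx, ?_⟩
      rw [hτ, div_mul_cancel₀ _ (hqpos x hx).ne', sub_self]
      exact lt_irrefl 0
    obtain ⟨w, hw0, hwc, hwM⟩ := ih _ hssub (fun v => c v - τ * q v)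
      (M - τ * partitionIn G lam S) hM' (fun v hv => (Finset.mem_filter.1 hv).2)
      (fun v hv => by
        by_cases hvS : v ∈ S
        · have : ¬ 0 < c v - τ * q v := fun h => hv (Finset.mem_filter.2 ⟨hvS, h⟩)
          linarith [hτle v]
        · simp [hq0 v hvS, hc0 v hvS])
      (fun u hu => hdrop u (Finset.mem_filter.1 hu).1)
    refine ⟨fun I => w I + if I ∈ indepSetsIn G S then τ * lam ^ I.card else 0, fun I => ?_,
      fun v => ?_, ?_⟩
    · refine add_nonneg (hw0 I) ?_
      split_ifs <;> positivity
    · rw [Finset.sum_add_distrib, hwc, ← Finset.sum_filter]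
      have : ((indepSets G).filter (fun I => v ∈ I)).filter (fun I => I ∈ indepSetsIn G S) =
          (indepSetsIn G S).filter (fun I => v ∈ I) := by
        ext I
        have := @indepSetsIn_subset_indepSets V _ G S I
        simp only [Finset.mem_filter]
        tauto
      rw [this, ← Finset.mul_sum, hq, occupiedWeight]
      ring
    · rw [Finset.sum_add_distrib, ← Finset.sum_filter, Finset.filter_mem_eq_inter,
        Finset.inter_eq_right.2 (indepSetsIn_subset_indepSets S), ← Finset.mul_sum]
      change _ + τ * partitionIn G lam S ≤ M
      linarith

open Classical in
theorem fractionalChromaticNumber_le [Nonempty V] (hlam : 0 < lam) {β γ : ℝ} {Δ : ℕ}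
    (hβ : 0 ≤ β) (hγ : 0 ≤ γ) (hdeg : ∀ v, (Finset.univ.filter (G.Adj v)).card ≤ Δ)
    (hloc : ∀ S : Finset V, ∀ u ∈ S, partitionIn G lam S ≤ β * occupiedWeight G lam S u +
      γ * ∑ v ∈ S.filter (G.Adj u), occupiedWeight G lam S v) :
    fractionalChromaticNumber G ≤ β + γ * Δ := by
  obtain ⟨w, hw0, hw1, hwM⟩ := exists_weights_of_localOccupancy hlam hβ hγ hloc Finset.univ
    (fun _ => 1) (β + γ * Δ) (by positivity) (by simp) (by simp) (fun u _ => by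
      simp only [mul_one, Finset.sum_const, nsmul_eq_mul]
      have : ((Finset.univ.filter (G.Adj u)).card : ℝ) ≤ Δ := by exact_mod_cast hdeg u
      gcongr)
  set T := ∑ I ∈ indepSets G, w I with hT
  have hT0 : 0 < T := by
    have v := Classical.arbitrary V
    have : ∑ I ∈ (indepSets G).filter (fun I => v ∈ I), w I ≤ T :=
      Finset.sum_le_sum_of_subset_of_nonneg (Finset.filter_subset _ _) fun I _ _ => hw0 I
    rw [hw1 v] at this
    linarith
  have hcol : IsFractionalColouring G T fun I => w I / T := by
    refine ⟨fun I _ => div_nonneg (hw0 I) hT0.le, ?_, fun u => ?_⟩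
    · rw [← Finset.sum_div, div_self hT0.ne']
    · rw [← Finset.sum_div, hw1 u]
  refine (csInf_le ?_ ?_).trans hwM
  · exact ⟨0, fun x hx => hx.1.le⟩
  · exact ⟨hT0, _, hcol⟩

/-- The two bounds for a single graph, with the parameters of `exists_parameters`. -/
theorem bounds_of_cycleGraph_free [Nonempty V] {k Δ : ℕ} {η ε : ℝ} (hk : 3 ≤ k) (hΔ : 0 < Δ)
    (hη0 : 0 < η) (hη : η < 1) (hηlam : η ≤ lam) (hε : 0 < ε)
    (hlog : 0 < Real.log ((Δ : ℝ) / k)) (hL : 0 < Real.log (η ^ 2 * ((Δ : ℝ) / k)))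
    (hpar : (4 * η + 1 / (1 - η)) / Real.log (η ^ 2 * ((Δ : ℝ) / k)) ≤
      (1 + ε) / Real.log ((Δ : ℝ) / k))
    [DecidableRel G.Adj] (hdeg : G.maxDegree = Δ) (hfree : (SimpleGraph.cycleGraph k).Free G) :
    (1 - ε) * (Real.log ((Δ : ℝ) / k) / Δ) ≤ occupancyFraction G lam ∧
      fractionalChromaticNumber G ≤ (1 + ε) * ((Δ : ℝ) / Real.log ((Δ : ℝ) / k)) := by
  classical
  have hk3 : (3 : ℝ) ≤ k := by exact_mod_cast hk
  have hk0 : (0 : ℝ) < k := by linarith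
  have hΔ0 : (0 : ℝ) < Δ := by exact_mod_cast hΔ
  have hη' : 0 < 1 - η := by linarith
  set L := Real.log (η ^ 2 * ((Δ : ℝ) / k)) with hLdef
  have hexpL : Real.exp L = η ^ 2 * ((Δ : ℝ) / k) := Real.exp_log (by positivity)
  set μ := η / (2 * k) with hμ
  have hμ0 : 0 < μ := by positivity
  have hμη : μ ≤ η := div_le_self hη0.le (by linarith)
  set β := (1 + μ) / μ * (Real.exp L / L) with hβ
  set γ := 1 / (L * (1 - η)) with hγ
  have hβ0 : 0 < β := by positivity
  have hγ0 : 0 < γ := by positivity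
  have hloc := localOccupancy_of_cycleGraph_free hk hfree hη0 hη hL hμ
  have hdeg' : ∀ v, (Finset.univ.filter (G.Adj v)).card ≤ Δ := by
    intro v
    rw [← SimpleGraph.neighborFinset_eq_filter, SimpleGraph.card_neighborFinset_eq_degree, ← hdeg]
    convert G.degree_le_maxDegree v
  have hβle : β ≤ 4 * η * Δ / L := by
    calc β ≤ 2 / μ * (Real.exp L / L) := by
          rw [hβ]; gcongr; linarith
      _ = 4 * η * Δ / L := by
          rw [hexpL, hμ]; field_simp; ring
  have hD : β + γ * Δ ≤ (1 + ε) * (Δ / Real.log ((Δ : ℝ) / k)) := by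
    calc β + γ * Δ ≤ 4 * η * Δ / L + γ * Δ := by gcongr
      _ = (4 * η + 1 / (1 - η)) / L * Δ := by rw [hγ]; field_simp
      _ ≤ (1 + ε) / Real.log ((Δ : ℝ) / k) * Δ := by gcongr
      _ = _ := by ring
  have hDpos : 0 < β + γ * Δ := by positivity
  refine ⟨?_, (fractionalChromaticNumber_le hμ0 hβ0.le hγ0.le
    (fun v => by convert hdeg' v) fun S u hu =>
    hloc S hu).trans hD⟩
  calc (1 - ε) * (Real.log ((Δ : ℝ) / k) / Δ)
      ≤ 1 / ((1 + ε) * (Δ / Real.log ((Δ : ℝ) / k))) := by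
        rw [show 1 / ((1 + ε) * (Δ / Real.log ((Δ : ℝ) / k))) =
          1 / (1 + ε) * (Real.log ((Δ : ℝ) / k) / Δ) by field_simp]
        gcongr
        rw [le_div_iff₀ (by positivity)]
        nlinarith [sq_nonneg ε]
    _ ≤ 1 / (β + γ * Δ) := one_div_le_one_div_of_le hDpos hD
    _ ≤ occupancyFraction G μ := one_div_le_occupancyFraction hμ0 hγ0.le hDpos
        (fun v => by convert hdeg' v) fun u =>
        hloc Finset.univ (Finset.mem_univ u)
    _ ≤ occupancyFraction G lam := by
        unfold occupancyFraction
        gcongr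
        exact expectedSize_mono hμ0 (hμη.trans hηlam)

end Global

end HardCore

theorem mainTheorem8 (lam : ℝ) (hlam : 0 < lam)
    (κ : ℕ → ℝ) (hκ : κ =o[atTop] fun Δ : ℕ => (Δ : ℝ)) :
    ∃ ε₁ ε₂ : ℕ → ℝ, Tendsto ε₁ atTop (𝓝 0) ∧ Tendsto ε₂ atTop (𝓝 0) ∧
      ∀ᶠ Δ : ℕ in atTop, ∀ k : ℕ, 3 ≤ k → (k : ℝ) ≤ κ Δ →
        ∀ (V : Type*) [Fintype V] (G : SimpleGraph V) [DecidableRel G.Adj],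
          G.maxDegree = Δ → (SimpleGraph.cycleGraph k).Free G →
            (1 - ε₁ Δ) * (Real.log ((Δ : ℝ) / k) / Δ) ≤ HardCore.occupancyFraction G lam ∧
            HardCore.fractionalChromaticNumber G ≤
              (1 + ε₂ Δ) * ((Δ : ℝ) / Real.log ((Δ : ℝ) / k)) := by
  suffices H : ∃ ε : ℕ → ℝ, Tendsto ε atTop (𝓝 0) ∧
      ∀ᶠ Δ : ℕ in atTop, ∀ k : ℕ, 3 ≤ k → (k : ℝ) ≤ κ Δ →
        ∀ (V : Type _) [Fintype V] (G : SimpleGraph V) [DecidableRel G.Adj],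
          G.maxDegree = Δ → (SimpleGraph.cycleGraph k).Free G →
            (1 - ε Δ) * (Real.log ((Δ : ℝ) / k) / Δ) ≤ HardCore.occupancyFraction G lam ∧
            HardCore.fractionalChromaticNumber G ≤
              (1 + ε Δ) * ((Δ : ℝ) / Real.log ((Δ : ℝ) / k)) by
    obtain ⟨ε, hε, h⟩ := H
    exact ⟨ε, ε, hε, hε, h⟩
  refine HardCore.exists_tendsto_zero_eventually (P := fun ε Δ => ∀ k : ℕ, 3 ≤ k → (k : ℝ) ≤ κ Δ →
    ∀ (V : Type _) [Fintype V] (G : SimpleGraph V) [DecidableRel G.Adj],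
      G.maxDegree = Δ → (SimpleGraph.cycleGraph k).Free G →
        (1 - ε) * (Real.log ((Δ : ℝ) / k) / Δ) ≤ HardCore.occupancyFraction G lam ∧
        HardCore.fractionalChromaticNumber G ≤ (1 + ε) * ((Δ : ℝ) / Real.log ((Δ : ℝ) / k)))
    fun ε hε => ?_
  obtain ⟨η, R, hη0, hη, hηlam, hR, hpar⟩ := HardCore.exists_parameters hlam hε
  filter_upwards [hκ.bound (inv_pos.2 hR), eventually_gt_atTop 0] with Δ hκΔ hΔ
  intro k hk hkκ V _ G _ hdeg hfree
  have hk0 : (0 : ℝ) < k := by positivity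
  have hΔk : R ≤ (Δ : ℝ) / k := by
    have h1 : (k : ℝ) ≤ R⁻¹ * Δ := by
      refine (hkκ.trans (le_abs_self _)).trans ?_
      simpa using hκΔ
    rw [le_div_iff₀ hk0]
    calc R * k ≤ R * (R⁻¹ * Δ) := by gcongr
      _ = Δ := by field_simp
  have : Nonempty V := by
    by_contra hne
    rw [not_nonempty_iff] at hne
    rw [SimpleGraph.maxDegree_of_subsingleton] at hdeg
    omega
  obtain ⟨h1, h2, h3⟩ := hpar _ hΔk
  exact HardCore.bounds_of_cycleGraph_free hk hΔ hη0 hη hηlam hε h1 h2 h3 hdeg hfree
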